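/- Let $R$ be a commutative Noetherian ring and let $C$ be a semidualizing $R$-module, i.e. a finitely generated $R$-module such that the homothety map $R\to \operatorname{Hom}_R(C,C)$ is an isomorphism and $\operatorname{Ext}^i_R(C,C)=0$ for all $i>0$. Write $X^C=\operatorname{Hom}_R(X,C)$. A finitely generated $R$-module $X$ is called totally $C$-reflexive if the natural biduality map $X\to X^{CC}$ is an isomorphism and $\operatorname{Ext}^i_R(X,C)=\operatorname{Ext}^i_R(X^C,C)=0$ for all $i>0$. The $G_C$-dimension $G_C\text{-}\dim_R(M)$ of a finitely generated $R$-module $M$ is the least integer $n\ge 0$ for which there is an exact sequence $0\to X_n\to\cdots\to X_0\to M\to 0$ with all $X_j$ totally $C$-reflexive ($\infty$ if there is none). The module $M$ is called reduced $G_C$-perfect if $G_C\text{-}\dim_R(M)<\infty$ and $$\inf\{i>0 \mid \operatorname{Ext}^i_R(M,C)\neq 0\} = G_C\text{-}\dim_R(M).$$ Given a presentation $P_1\xrightarrow{f}P_0\to M\to 0$ with $P_0,P_1$ finitely generated projective $R$-modules, the module $\operatorname{Tr}_C(M)=\operatorname{Coker}(f^C\colon P_0^C\to P_1^C)$ is called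 a transpose of $M$ with respect to $C$. **Proposition.** Let $M$ be a reduced $G_C$-perfect $R$-module of $G_C$-dimension $n$. Then, for every such transpose $\operatorname{Tr}_C(M)$ (computed from any presentation of $M$ by finitely generated projective modules) and for all $i>0$, there is an isomorphism of $R$-modules $$\operatorname{Ext}^i_R(\operatorname{Tr}_C(M),C)\;\cong\;\operatorname{Ext}^{i+n-1}_R(\operatorname{Ext}^n_R(M,C),C).$$ -/

import Mathlib

universe u

noncomputable section

namespace RelG

variable (R : Type u) [CommRing R]

/-- The `R`-module `Ext^i_R(M, N)`. -/
abbrev ExtMod (M N : Type u) [AddCommGroup M] [Module R M] [AddCommGroup N] [Module R N]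
    (i : ℕ) : Type u :=
  CategoryTheory.Abelian.Ext (ModuleCat.of R M) (ModuleCat.of R N) i

/-- `C` is a semidualizing `R`-module: it is finitely generated, the homothety map
`R → Hom_R(C, C)` is an isomorphism, and `Ext^i_R(C, C) = 0` for all `i > 0`. -/
structure IsSemidualizing (C : Type u) [AddCommGroup C] [Module R C] : Prop where
  finite : Module.Finite R C
  homothety_bijective : Function.Bijective (LinearMap.lsmul R C)
  ext_eq_zero : ∀ i : ℕ, 0 < i → Subsingleton (ExtMod R C C i)

variable (C : Type u) [AddCommGroup C] [Module R C]

section Modules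

variable (M : Type u) [AddCommGroup M] [Module R M]

/-- The natural biduality map `M → Hom_R(Hom_R(M, C), C)`, `x ↦ (f ↦ f x)`. -/
def biduality : M →ₗ[R] ((M →ₗ[R] C) →ₗ[R] C) := LinearMap.applyₗ

/-- `M` is totally `C`-reflexive: it is finitely generated, the biduality map is an isomorphism,
and `Ext^i_R(M, C) = 0 = Ext^i_R(Hom_R(M, C), C)` for all `i > 0`. -/
structure IsTotallyReflexive : Prop where
  finite : Module.Finite R M
  biduality_bijective : Function.Bijective (biduality R C M)
  ext_eq_zero : ∀ i : ℕ, 0 < i → Subsingleton (ExtMod R M C i)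
  ext_dual_eq_zero : ∀ i : ℕ, 0 < i → Subsingleton (ExtMod R (M →ₗ[R] C) C i)

/-- There is an exact sequence `0 → X n → ⋯ → X 1 → X 0 → M → 0` with all `X i` totally
`C`-reflexive (written as an infinite exact sequence with `X i = 0` for `i > n`). -/
def HasGCResolution (n : ℕ) : Prop :=
  ∃ (X : ℕ → ModuleCat.{u} R) (d : ∀ i, X (i + 1) →ₗ[R] X i) (ε : X 0 →ₗ[R] M),
    (∀ i, IsTotallyReflexive R C (X i)) ∧
    (∀ i, n < i → Subsingleton (X i)) ∧
    Function.Surjective ε ∧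
    Function.Exact (d 0) ε ∧
    ∀ i, Function.Exact (d (i + 1)) (d i)

/-- The `G_C`-dimension of `M`: the least `n` such that `M` has a `G_C`-resolution of length `n`,
and `⊤` if there is none. -/
def gcDim : ℕ∞ := ⨅ (n : ℕ) (_ : HasGCResolution R C M n), (n : ℕ∞)

/-- The reduced grade of `M` with respect to `C`: the least `i > 0` with `Ext^i_R(M, C) ≠ 0`,
and `⊤` if there is none. -/
def rGrade : ℕ∞ := ⨅ (i : ℕ) (_ : 0 < i) (_ : Nontrivial (ExtMod R M C i)), (i : ℕ∞)

/-- `M` is reduced `G_C`-perfect: it is finitely generated, of finite `G_C`-dimension, and its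
reduced grade with respect to `C` equals its `G_C`-dimension. -/
structure IsReducedGCPerfect : Prop where
  finite : Module.Finite R M
  gcDim_ne_top : gcDim R C M ≠ ⊤
  rGrade_eq_gcDim : rGrade R C M = gcDim R C M

end Modules

/-- A presentation `P₁ → P₀ → M → 0` by finitely generated projective modules, with maps
`f : P₁ → P₀` and `g : P₀ → M`. -/
structure IsProjectivePresentation {P₁ P₀ M : Type u} [AddCommGroup P₁] [Module R P₁]
    [AddCommGroup P₀] [Module R P₀] [AddCommGroup M] [Module R M]
    (f : P₁ →ₗ[R] P₀) (g : P₀ →ₗ[R] M) : Prop where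
  finite_one : Module.Finite R P₁
  projective_one : Module.Projective R P₁
  finite_zero : Module.Finite R P₀
  projective_zero : Module.Projective R P₀
  exact : Function.Exact f g
  surjective : Function.Surjective g

/-- The transpose with respect to `C` computed from the first map `f : P₁ → P₀` of a projective
presentation: the cokernel of `Hom_R(f, C) : Hom_R(P₀, C) → Hom_R(P₁, C)`. -/
abbrev Transpose {P₁ P₀ : Type u} [AddCommGroup P₁] [Module R P₁] [AddCommGroup P₀] [Module R P₀]
    (f : P₁ →ₗ[R] P₀) : Type u :=
  (P₁ →ₗ[R] C) ⧸ LinearMap.range (LinearMap.lcomp R C f)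

end RelG

end

/-! Write `Ω = ker g`. Reduced perfection forces `n ≥ 1`, and the proof is an induction on `n` along
syzygies. For `n = 1` both `Ω` and `L = ker (P₁ → Ω)` are totally `C`-reflexive. Dualizing `0 → L →
P₁ → Ω → 0` and dividing by the image of `P₀^C` gives `0 → Ext¹(M, C) → Tr_C M → L^C → 0`. Since
`L^C` has no higher Ext into `C`, the outer Ext modules agree in positive degrees
(`nonempty_ext_transpose_equiv_ext_ext_one`). For larger `n`, take a free module `F` mapping onto
`L`. As `Ext¹(M, C) = 0`, the complex `P₀^C → P₁^C → F^C` is exact, so `0 → Tr_C M → F^C → Tr_C Ω →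
0` is exact and shifts the degree by one. The induction continues because a syzygy lowers the
resolution length by one (`ReflexiveDimLE.syzygy`). -/

namespace RelG

open CategoryTheory CategoryTheory.Abelian

/-! ### Short exact sequences of modules. -/

section ShortExact

variable {R : Type u} [CommRing R]

/-- `0 → A → B → D → 0` is a short exact sequence of modules. -/
structure IsShortExact {A B D : Type u} [AddCommGroup A] [Module R A] [AddCommGroup B] [Module R B]
    [AddCommGroup D] [Module R D] (a : A →ₗ[R] B) (b : B →ₗ[R] D) : Prop where
  injective : Function.Injective a
  exact : Function.Exact a b
  surjective : Function.Surjective b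

variable {A B D : Type u} [AddCommGroup A] [Module R A] [AddCommGroup B] [Module R B]
  [AddCommGroup D] [Module R D] {a : A →ₗ[R] B} {b : B →ₗ[R] D}

/-- The short complex in `ModuleCat R` of a short exact sequence of modules. -/
noncomputable def IsShortExact.shortComplex (h : IsShortExact a b) :
    ShortComplex (ModuleCat.{u} R) :=
  ShortComplex.mk (ModuleCat.ofHom a) (ModuleCat.ofHom b) (by
    ext x
    exact h.exact.apply_apply_eq_zero x)

theorem IsShortExact.shortExact (h : IsShortExact a b) : h.shortComplex.ShortExact where
  exact := (ShortComplex.ShortExact.moduleCat_exact_iff_function_exact _).2 h.exact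
  mono_f := (ModuleCat.mono_iff_injective _).2 h.injective
  epi_g := (ModuleCat.epi_iff_surjective _).2 h.surjective

theorem isShortExact_subtype_ker (h : Function.Surjective b) :
    IsShortExact (LinearMap.ker b).subtype b :=
  ⟨Subtype.val_injective, LinearMap.exact_subtype_ker_map b, h⟩

theorem IsShortExact.congr_right {D' : Type u} [AddCommGroup D'] [Module R D']
    (h : IsShortExact a b) (e : D ≃ₗ[R] D') : IsShortExact a (e.toLinearMap ∘ₗ b) where
  injective := h.injective
  exact := fun x => by
    rw [← h.exact x]
    simp
  surjective := e.surjective.comp h.surjective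

end ShortExact

/-! ### The contravariant long exact Ext sequence and dimension shifting. -/

section Ext

variable {R : Type u} [CommRing R] {A B D : Type u} [AddCommGroup A] [Module R A]
  [AddCommGroup B] [Module R B] [AddCommGroup D] [Module R D]
  (C : Type u) [AddCommGroup C] [Module R C]

/-- The map `Ext^i_R(B, C) → Ext^i_R(A, C)` induced by a linear map `A → B`. -/
noncomputable def extMap (φ : A →ₗ[R] B) (i : ℕ) : ExtMod R B C i →ₗ[R] ExtMod R A C i :=
  (Ext.mk₀ (ModuleCat.ofHom φ)).precompOfLinear R (ModuleCat.of R C) (zero_add i)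

theorem extMap_comp_apply (φ : A →ₗ[R] B) (ψ : B →ₗ[R] D) (i : ℕ) (x : ExtMod R D C i) :
    extMap C (ψ ∘ₗ φ) i x = extMap C φ i (extMap C ψ i x) := by
  simp [extMap, ModuleCat.ofHom_comp, ← Ext.mk₀_comp_mk₀_assoc]

theorem extMap_id_apply (i : ℕ) (x : ExtMod R A C i) :
    extMap C (LinearMap.id : A →ₗ[R] A) i x = x := by
  have : ModuleCat.ofHom (LinearMap.id : A →ₗ[R] A) = 𝟙 (ModuleCat.of R A) := rfl
  simp [extMap, this]

/-- `Ext^i_R(-, C)` preserves linear equivalences. -/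
noncomputable def extCongr (e : A ≃ₗ[R] B) (i : ℕ) : ExtMod R B C i ≃ₗ[R] ExtMod R A C i :=
  LinearEquiv.ofLinearMap (extMap C e.toLinearMap i) (extMap C e.symm.toLinearMap i)
    (by ext x; simp [← extMap_comp_apply, extMap_id_apply])
    (by ext x; simp [← extMap_comp_apply, extMap_id_apply])

theorem subsingleton_ext_of_retract {s : A →ₗ[R] B} {r : B →ₗ[R] A} (h : r ∘ₗ s = LinearMap.id)
    {i : ℕ} (hB : Subsingleton (ExtMod R B C i)) : Subsingleton (ExtMod R A C i) := by
  refine ⟨fun x y => ?_⟩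
  rw [← extMap_id_apply C i x, ← extMap_id_apply C i y, ← h, extMap_comp_apply, extMap_comp_apply]
  congr 1
  exact Subsingleton.elim _ _

theorem subsingleton_ext_of_projective [Module.Projective R A] {i : ℕ} (hi : 0 < i) :
    Subsingleton (ExtMod R A C i) := by
  obtain ⟨i, rfl⟩ := Nat.exists_eq_add_of_lt hi
  have : Projective (ModuleCat.of R A) := (IsProjective.iff_projective A).1 inferInstance
  exact ⟨fun x y => by rw [Ext.eq_zero_of_projective x, Ext.eq_zero_of_projective y]⟩

variable {a : A →ₗ[R] B} {b : B →ₗ[R] D}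

/-- The connecting map `Ext^i_R(A, C) → Ext^{i+1}_R(D, C)` of a short exact sequence
`0 → A → B → D → 0`. -/
noncomputable def IsShortExact.connecting (h : IsShortExact a b) (i : ℕ) : ExtMod R A C i →ₗ[R] ExtMod R D C (i + 1) :=
  h.shortExact.extClass.precompOfLinear R (ModuleCat.of R C) (add_comm 1 i)

theorem IsShortExact.exact_extMap_extMap (h : IsShortExact a b) (i : ℕ) :
    Function.Exact (extMap C b i) (extMap C a i) := by
  intro x
  constructor
  · intro hx
    exact Ext.contravariant_sequence_exact₂ h.shortExact (ModuleCat.of R C) x hx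
  · rintro ⟨y, rfl⟩
    rw [← extMap_comp_apply, h.exact.linearMap_comp_eq_zero]
    have : ModuleCat.ofHom (0 : A →ₗ[R] D) = 0 := rfl
    simp [extMap, this]

theorem IsShortExact.exact_extMap_connecting (h : IsShortExact a b) (i : ℕ) :
    Function.Exact (extMap C a i) (h.connecting C i) := by
  intro x
  constructor
  · intro hx
    exact Ext.contravariant_sequence_exact₁ h.shortExact (ModuleCat.of R C) x (add_comm 1 i) hx
  · rintro ⟨y, rfl⟩
    exact h.shortExact.extClass_comp_assoc y (h := add_comm 1 i)

theorem IsShortExact.exact_connecting_extMap (h : IsShortExact a b) (i : ℕ) :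
    Function.Exact (h.connecting C i) (extMap C b (i + 1)) := by
  intro x
  constructor
  · intro hx
    exact Ext.contravariant_sequence_exact₃ h.shortExact (ModuleCat.of R C) x hx (add_comm 1 i)
  · rintro ⟨y, rfl⟩
    exact h.shortExact.comp_extClass_assoc y (add_comm 1 i)

/-- `Ext^0_R(A, C)` is `Hom_R(A, C)`. -/
noncomputable def extZeroEquiv : (A →ₗ[R] C) ≃ₗ[R] ExtMod R A C 0 :=
  (ModuleCat.homLinearEquiv (S := R) (M := ModuleCat.of R A) (N := ModuleCat.of R C)).symm.trans
    Ext.linearEquiv₀.symm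

theorem extMap_extZeroEquiv (φ : A →ₗ[R] B) (f : B →ₗ[R] C) :
    extMap C φ 0 (extZeroEquiv C f) = extZeroEquiv C (f ∘ₗ φ) := by
  simp [extMap, extZeroEquiv, ModuleCat.homLinearEquiv]
  rfl

variable {C}

theorem IsShortExact.lcomp_surjective (h : IsShortExact a b)
    (hD : Subsingleton (ExtMod R D C 1)) : Function.Surjective (LinearMap.lcomp R C a) := by
  intro f
  obtain ⟨y, hy⟩ := (h.exact_extMap_connecting C 0 (extZeroEquiv C f)).1 (Subsingleton.elim _ _)
  obtain ⟨g, rfl⟩ := (extZeroEquiv C).surjective y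
  rw [extMap_extZeroEquiv] at hy
  exact ⟨g, (extZeroEquiv C).injective hy⟩

/-- Degree-zero companion of `subsingleton_ext_right`: `Hom(A, C)` need not vanish, but if every map
on `A` extends to `B`, the connecting map is zero. -/
theorem IsShortExact.subsingleton_ext_one (h : IsShortExact a b)
    (hB : Subsingleton (ExtMod R B C 1)) (ha : Function.Surjective (LinearMap.lcomp R C a)) :
    Subsingleton (ExtMod R D C 1) := by
  refine subsingleton_of_forall_eq 0 fun x => ?_
  obtain ⟨y, rfl⟩ := (h.exact_connecting_extMap C 0 x).1 (Subsingleton.elim _ _)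
  obtain ⟨f, rfl⟩ := (extZeroEquiv C).surjective y
  obtain ⟨g, rfl⟩ := ha f
  refine (h.exact_extMap_connecting C 0 _).2 ⟨extZeroEquiv C g, ?_⟩
  rw [extMap_extZeroEquiv]
  rfl

/-- If `Ext^1_R(B, C) = 0`, then a short exact sequence `0 → A → B → D → 0` identifies
`Ext^1_R(D, C)` with the cokernel of `Hom_R(B, C) → Hom_R(A, C)`. -/
theorem IsShortExact.nonempty_cokernel_equiv_ext_one (h : IsShortExact a b)
    (hB : Subsingleton (ExtMod R B C 1)) :
    Nonempty (((A →ₗ[R] C) ⧸ LinearMap.range (LinearMap.lcomp R C a)) ≃ₗ[R] ExtMod R D C 1) := by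
  let δ : (A →ₗ[R] C) →ₗ[R] ExtMod R D C 1 := h.connecting C 0 ∘ₗ (extZeroEquiv C).toLinearMap
  have hδ : LinearMap.ker δ = LinearMap.range (LinearMap.lcomp R C a) := by
    ext f
    constructor
    · intro hf
      obtain ⟨y, hy⟩ := (h.exact_extMap_connecting C 0 (extZeroEquiv C f)).1 hf
      obtain ⟨g, rfl⟩ := (extZeroEquiv C).surjective y
      rw [extMap_extZeroEquiv] at hy
      exact ⟨g, (extZeroEquiv C).injective hy⟩
    · rintro ⟨g, rfl⟩
      refine (h.exact_extMap_connecting C 0 _).2 ⟨extZeroEquiv C g, ?_⟩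
      rw [extMap_extZeroEquiv]
      rfl
  have hs : Function.Surjective δ := fun x => by
    obtain ⟨y, rfl⟩ := (h.exact_connecting_extMap C 0 x).1 (Subsingleton.elim _ _)
    obtain ⟨f, rfl⟩ := (extZeroEquiv C).surjective y
    exact ⟨f, rfl⟩
  exact ⟨(Submodule.quotEquivOfEq _ _ hδ.symm).trans (δ.quotKerEquivOfSurjective hs)⟩

theorem IsShortExact.subsingleton_ext_left (h : IsShortExact a b) {i : ℕ}
    (hB : Subsingleton (ExtMod R B C i)) (hD : Subsingleton (ExtMod R D C (i + 1))) :
    Subsingleton (ExtMod R A C i) := by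
  refine subsingleton_of_forall_eq 0 fun x => ?_
  obtain ⟨y, rfl⟩ := (h.exact_extMap_connecting C i x).1 (Subsingleton.elim _ _)
  rw [Subsingleton.elim y 0, map_zero]

theorem IsShortExact.subsingleton_ext_middle (h : IsShortExact a b) {i : ℕ}
    (hA : Subsingleton (ExtMod R A C i)) (hD : Subsingleton (ExtMod R D C i)) :
    Subsingleton (ExtMod R B C i) := by
  refine subsingleton_of_forall_eq 0 fun x => ?_
  obtain ⟨y, rfl⟩ := (h.exact_extMap_extMap C i x).1 (Subsingleton.elim _ _)
  rw [Subsingleton.elim y 0, map_zero]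

theorem IsShortExact.subsingleton_ext_right (h : IsShortExact a b) {i : ℕ}
    (hA : Subsingleton (ExtMod R A C i)) (hB : Subsingleton (ExtMod R B C (i + 1))) :
    Subsingleton (ExtMod R D C (i + 1)) := by
  refine subsingleton_of_forall_eq 0 fun x => ?_
  obtain ⟨y, rfl⟩ := (h.exact_connecting_extMap C i x).1 (Subsingleton.elim _ _)
  rw [Subsingleton.elim y 0, map_zero]

/-- Dimension shifting. -/
noncomputable def IsShortExact.connectingEquiv (h : IsShortExact a b) {i : ℕ}
    (hB : Subsingleton (ExtMod R B C i)) (hB' : Subsingleton (ExtMod R B C (i + 1))) :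
    ExtMod R A C i ≃ₗ[R] ExtMod R D C (i + 1) :=
  LinearEquiv.ofBijective (h.connecting C i) <| by
    constructor
    · rw [injective_iff_map_eq_zero]
      intro x hx
      obtain ⟨y, rfl⟩ := (h.exact_extMap_connecting C i x).1 hx
      rw [Subsingleton.elim y 0, map_zero]
    · exact fun x => (h.exact_connecting_extMap C i x).1 (Subsingleton.elim _ _)

/-- If `Ext^i_R(D, C) = Ext^{i+1}_R(D, C) = 0`, then a short exact sequence `0 → A → B → D → 0`
identifies `Ext^i_R(B, C)` with `Ext^i_R(A, C)`. -/
noncomputable def IsShortExact.extMapEquiv (h : IsShortExact a b) {i : ℕ}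
    (hD : Subsingleton (ExtMod R D C i)) (hD' : Subsingleton (ExtMod R D C (i + 1))) :
    ExtMod R B C i ≃ₗ[R] ExtMod R A C i :=
  LinearEquiv.ofBijective (extMap C a i) <| by
    constructor
    · rw [injective_iff_map_eq_zero]
      intro x hx
      obtain ⟨y, rfl⟩ := (h.exact_extMap_extMap C i x).1 hx
      rw [Subsingleton.elim y 0, map_zero]
    · exact fun x => (h.exact_extMap_connecting C i x).1 (Subsingleton.elim _ _)

theorem IsShortExact.lcomp (h : IsShortExact a b) (hD : Subsingleton (ExtMod R D C 1)) :
    IsShortExact (LinearMap.lcomp R C b) (LinearMap.lcomp R C a) where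
  injective := LinearMap.lcomp_injective_of_surjective b h.surjective
  exact := LinearMap.exact_lcomp_of_exact_of_surjective C h.exact h.surjective
  surjective := h.lcomp_surjective hD

end Ext

/-! ### Closure properties of totally `C`-reflexive modules. -/

section TotallyReflexive

variable {R : Type u} [CommRing R] {C : Type u} [AddCommGroup C] [Module R C]
  {A B D : Type u} [AddCommGroup A] [Module R A]
  [AddCommGroup B] [Module R B] [AddCommGroup D] [Module R D]

/-- Biduality is natural and Ext is functorial, so every condition passes to retracts; this reduces
finitely generated projectives to free modules. -/
theorem IsTotallyReflexive.of_retract (hB : IsTotallyReflexive R C B) {s : A →ₗ[R] B}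
    {r : B →ₗ[R] A} (h : r ∘ₗ s = LinearMap.id) : IsTotallyReflexive R C A := by
  have hr : ∀ x, r (s x) = x := fun x => LinearMap.congr_fun h x
  refine ⟨?_, ⟨?_, ?_⟩, ?_, ?_⟩
  · have := hB.finite
    exact Module.Finite.of_surjective r fun x => ⟨s x, hr x⟩
  · rw [injective_iff_map_eq_zero]
    intro x hx
    have : s x = 0 := by
      refine (injective_iff_map_eq_zero _).1 hB.biduality_bijective.1 _ ?_
      ext f
      exact LinearMap.congr_fun hx (f ∘ₗ s)
    rw [← hr x, this, map_zero]
  · intro φ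
    obtain ⟨y, hy⟩ := hB.biduality_bijective.2 (φ ∘ₗ LinearMap.lcomp R C s)
    refine ⟨r y, ?_⟩
    ext f
    refine (LinearMap.congr_fun hy (f ∘ₗ r)).trans ?_
    change φ ((f ∘ₗ r) ∘ₗ s) = φ f
    rw [LinearMap.comp_assoc, h, LinearMap.comp_id]
  · exact fun i hi => subsingleton_ext_of_retract C h (hB.ext_eq_zero i hi)
  · refine fun i hi => subsingleton_ext_of_retract C (s := LinearMap.lcomp R C r)
      (r := LinearMap.lcomp R C s) ?_ (hB.ext_dual_eq_zero i hi)
    ext f x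
    simp [hr]

theorem IsTotallyReflexive.of_equiv (hB : IsTotallyReflexive R C B) (e : A ≃ₗ[R] B) :
    IsTotallyReflexive R C A :=
  hB.of_retract (s := e.toLinearMap) (r := e.symm.toLinearMap) (by ext; simp)

theorem isShortExact_inl_snd : IsShortExact (LinearMap.inl R A B) (LinearMap.snd R A B) :=
  ⟨LinearMap.inl_injective, Function.Exact.inl_snd, LinearMap.snd_surjective⟩

theorem IsTotallyReflexive.prod (hA : IsTotallyReflexive R C A) (hB : IsTotallyReflexive R C B) :
    IsTotallyReflexive R C (A × B) := by
  have hinl : Function.Surjective (LinearMap.lcomp R C (LinearMap.inl R A B)) :=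
    fun f => ⟨f ∘ₗ LinearMap.fst R A B, by ext; simp⟩
  refine ⟨?_, ⟨?_, ?_⟩, ?_, ?_⟩
  · have := hA.finite
    have := hB.finite
    infer_instance
  · rw [injective_iff_map_eq_zero]
    rintro ⟨x, y⟩ h
    refine Prod.ext ?_ ?_
    · refine (injective_iff_map_eq_zero _).1 hA.biduality_bijective.1 _ ?_
      ext f
      exact LinearMap.congr_fun h (f ∘ₗ LinearMap.fst R A B)
    · refine (injective_iff_map_eq_zero _).1 hB.biduality_bijective.1 _ ?_
      ext f
      exact LinearMap.congr_fun h (f ∘ₗ LinearMap.snd R A B)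
  · intro φ
    obtain ⟨x, hx⟩ := hA.biduality_bijective.2 (φ ∘ₗ LinearMap.lcomp R C (LinearMap.fst R A B))
    obtain ⟨y, hy⟩ := hB.biduality_bijective.2 (φ ∘ₗ LinearMap.lcomp R C (LinearMap.snd R A B))
    refine ⟨(x, y), ?_⟩
    ext f
    have hf : f = (f ∘ₗ LinearMap.inl R A B) ∘ₗ LinearMap.fst R A B +
        (f ∘ₗ LinearMap.inr R A B) ∘ₗ LinearMap.snd R A B := by
      ext <;> simp [← map_add]
    have h₁ := LinearMap.congr_fun hx (f ∘ₗ LinearMap.inl R A B)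
    have h₂ := LinearMap.congr_fun hy (f ∘ₗ LinearMap.inr R A B)
    rw [hf, map_add, map_add]
    exact congrArg₂ (· + ·) h₁ h₂
  · exact fun i hi => isShortExact_inl_snd.subsingleton_ext_middle (hA.ext_eq_zero i hi)
      (hB.ext_eq_zero i hi)
  · refine fun i hi => IsShortExact.subsingleton_ext_middle (a := LinearMap.lcomp R C
      (LinearMap.snd R A B)) (b := LinearMap.lcomp R C (LinearMap.inl R A B)) ?_
      (hB.ext_dual_eq_zero i hi) (hA.ext_dual_eq_zero i hi)
    exact ⟨LinearMap.lcomp_injective_of_surjective _ LinearMap.snd_surjective,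
      LinearMap.exact_lcomp_of_exact_of_surjective C isShortExact_inl_snd.exact
        LinearMap.snd_surjective, hinl⟩

/-- Under `Hom(R, C) ≃ C`, the biduality map of `R` becomes the homothety map of `C`. -/
theorem IsSemidualizing.isTotallyReflexive_self (hC : IsSemidualizing R C) :
    IsTotallyReflexive R C R := by
  refine ⟨inferInstance, ⟨?_, ?_⟩, fun i hi => subsingleton_ext_of_projective C hi, ?_⟩
  · rw [injective_iff_map_eq_zero]
    intro x hx
    refine (injective_iff_map_eq_zero _).1 hC.homothety_bijective.1 _ ?_
    ext c
    simpa [biduality] using LinearMap.congr_fun hx (LinearMap.toSpanSingleton R C c)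
  · intro φ
    obtain ⟨x, hx⟩ := hC.homothety_bijective.2
      (φ ∘ₗ (LinearMap.ringLmapEquivSelf R R C).symm.toLinearMap)
    refine ⟨x, ?_⟩
    ext f
    have h := LinearMap.congr_fun hx (f 1)
    have hf : (LinearMap.ringLmapEquivSelf R R C).symm (f 1) = f := by ext; simp
    simp only [LinearMap.lsmul_apply, LinearMap.comp_apply, LinearEquiv.coe_coe, hf] at h
    rw [← h, ← map_smul]
    simp [biduality]
  · intro i hi
    have := hC.ext_eq_zero i hi
    exact (extCongr C (LinearMap.ringLmapEquivSelf R R C) i).symm.injective.subsingleton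

theorem IsSemidualizing.isTotallyReflexive_fin (hC : IsSemidualizing R C) (n : ℕ) :
    IsTotallyReflexive R C (Fin n → R) := by
  induction n with
  | zero => exact hC.isTotallyReflexive_self.of_retract (s := 0) (r := 0) (Subsingleton.elim _ _)
  | succ n ih =>
    exact (hC.isTotallyReflexive_self.prod ih).of_equiv (Fin.consLinearEquiv R (fun _ => R)).symm

theorem IsSemidualizing.isTotallyReflexive_of_projective (hC : IsSemidualizing R C)
    [Module.Finite R A] [Module.Projective R A] : IsTotallyReflexive R C A := by
  obtain ⟨n, r, s, -, -, h⟩ := Module.Finite.exists_comp_eq_id_of_projective R A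
  exact (hC.isTotallyReflexive_fin n).of_retract h

/-- Since `Ext¹(D, C) = 0` the dual sequence is exact, and biduality for `A` follows by a diagram
chase. Noetherianity gives finiteness of `A`. -/
theorem IsShortExact.isTotallyReflexive_left [IsNoetherianRing R] {a : A →ₗ[R] B} {b : B →ₗ[R] D}
    (h : IsShortExact a b) (hB : IsTotallyReflexive R C B) (hD : IsTotallyReflexive R C D) :
    IsTotallyReflexive R C A := by
  have hdual : IsShortExact (LinearMap.lcomp R C b) (LinearMap.lcomp R C a) :=
    h.lcomp (hD.ext_eq_zero 1 one_pos)
  refine ⟨?_, ⟨?_, ?_⟩, ?_, ?_⟩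
  · have := hB.finite
    exact Module.Finite.of_injective a h.injective
  · rw [injective_iff_map_eq_zero]
    intro x hx
    refine (injective_iff_map_eq_zero _).1 h.injective _ ?_
    refine (injective_iff_map_eq_zero _).1 hB.biduality_bijective.1 _ ?_
    ext f
    exact LinearMap.congr_fun hx (f ∘ₗ a)
  · intro φ
    obtain ⟨y, hy⟩ := hB.biduality_bijective.2 (φ ∘ₗ LinearMap.lcomp R C a)
    have hy' : ∀ f : B →ₗ[R] C, f y = φ (f ∘ₗ a) := LinearMap.congr_fun hy
    have : b y = 0 := by
      refine (injective_iff_map_eq_zero _).1 hD.biduality_bijective.1 _ ?_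
      ext g
      refine (hy' (g ∘ₗ b)).trans ?_
      rw [LinearMap.comp_assoc, h.exact.linearMap_comp_eq_zero, LinearMap.comp_zero, map_zero]
      rfl
    obtain ⟨x, rfl⟩ := (h.exact y).1 this
    refine ⟨x, ?_⟩
    ext f
    obtain ⟨g, rfl⟩ := hdual.surjective f
    exact hy' g
  · exact fun i hi => h.subsingleton_ext_left (hB.ext_eq_zero i hi)
      (hD.ext_eq_zero (i + 1) i.succ_pos)
  · intro i hi
    obtain ⟨i, rfl⟩ := Nat.exists_eq_succ_of_ne_zero hi.ne'
    rcases Nat.eq_zero_or_pos i with rfl | hi'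
    -- A functional on `D^C` is evaluation at some `d`; evaluation at a preimage of `d` in `B`
    -- extends it to `B^C`.
    · refine hdual.subsingleton_ext_one (hB.ext_dual_eq_zero 1 one_pos) fun φ => ?_
      obtain ⟨d, rfl⟩ := hD.biduality_bijective.2 φ
      obtain ⟨y, rfl⟩ := h.surjective d
      exact ⟨biduality R C B y, rfl⟩
    · exact hdual.subsingleton_ext_right (hD.ext_dual_eq_zero i hi')
        (hB.ext_dual_eq_zero (i + 1) i.succ_pos)

end TotallyReflexive

/-! ### Resolution length and syzygies. -/

section ReflexiveDim

variable {R : Type u} [CommRing R] {C : Type u} [AddCommGroup C] [Module R C]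

variable (R C) in
/-- Inductive form of the existence of a resolution of length `n` by totally `C`-reflexive
modules. -/
inductive ReflexiveDimLE : ℕ → ∀ (M : Type u) [AddCommGroup M] [Module R M], Prop
  | zero {M : Type u} [AddCommGroup M] [Module R M] (hM : IsTotallyReflexive R C M) :
      ReflexiveDimLE 0 M
  | succ {n : ℕ} {K X M : Type u} [AddCommGroup K] [Module R K] [AddCommGroup X] [Module R X]
      [AddCommGroup M] [Module R M] {a : K →ₗ[R] X} {b : X →ₗ[R] M} (h : IsShortExact a b)
      (hX : IsTotallyReflexive R C X) (hK : ReflexiveDimLE n K) : ReflexiveDimLE (n + 1) M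

theorem ReflexiveDimLE.of_equiv {n : ℕ} {M N : Type u} [AddCommGroup M] [Module R M]
    [AddCommGroup N] [Module R N] (hM : ReflexiveDimLE R C n M) (e : M ≃ₗ[R] N) :
    ReflexiveDimLE R C n N := by
  cases hM with
  | zero hM => exact .zero (hM.of_equiv e.symm)
  | succ h hX hK => exact .succ (h.congr_right e) hX hK

theorem HasGCResolution.reflexiveDimLE {n : ℕ} {M : Type u} [AddCommGroup M] [Module R M]
    (hM : HasGCResolution R C M n) : ReflexiveDimLE R C n M := by
  induction n generalizing M with
  | zero =>
    obtain ⟨X, d, ε, hX, hX0, hε, hd, -⟩ := hM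
    refine ReflexiveDimLE.of_equiv (.zero (hX 0)) (LinearEquiv.ofBijective ε ⟨?_, hε⟩)
    rw [injective_iff_map_eq_zero]
    intro x hx
    obtain ⟨y, rfl⟩ := (hd x).1 hx
    have := hX0 1 one_pos
    rw [Subsingleton.elim y 0, map_zero]
  | succ n ih =>
    obtain ⟨X, d, ε, hX, hX0, hε, hd, hdd⟩ := hM
    refine .succ (isShortExact_subtype_ker hε) (hX 0) (ih ?_)
    refine ⟨fun i => X (i + 1), fun i => d (i + 1),
      (d 0).codRestrict _ fun x => hd.apply_apply_eq_zero x, fun i => hX (i + 1),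
      fun i hi => hX0 (i + 1) (by lia), ?_, ?_, fun i => hdd (i + 1)⟩
    · rintro ⟨x, hx⟩
      obtain ⟨y, rfl⟩ := (hd x).1 hx
      exact ⟨y, rfl⟩
    · intro x
      rw [← hdd 0 x]
      exact Subtype.ext_iff

/-- Adding `P` to the degree-zero term leaves the kernel `K` unchanged, so no induction is needed.
-/
theorem ReflexiveDimLE.prod_projective (hC : IsSemidualizing R C) {n : ℕ} {M P : Type u}
    [AddCommGroup M] [Module R M] [AddCommGroup P] [Module R P] [Module.Finite R P]
    [Module.Projective R P] (hM : ReflexiveDimLE R C n M) : ReflexiveDimLE R C n (M × P) := by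
  have hP : IsTotallyReflexive R C P := hC.isTotallyReflexive_of_projective
  cases hM with
  | zero hM => exact .zero (hM.prod hP)
  | @succ _ K X _ _ _ _ _ _ _ a b h hX hK =>
    refine .succ (a := LinearMap.inl R X P ∘ₗ a) (b := b.prodMap LinearMap.id) ⟨?_, ?_, ?_⟩
      (hX.prod hP) hK
    · exact LinearMap.inl_injective.comp h.injective
    · rintro ⟨x, y⟩
      simp [Prod.ext_iff, h.exact x, @eq_comm _ 0 y]
    · exact h.surjective.prodMap Function.surjective_id

/-- If `q : Y → M` starts a resolution with kernel `K`, then `ker (b ∘ q)` is totally reflexive and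
maps onto `ker b` with the same kernel `K`. -/
theorem ReflexiveDimLE.ker [IsNoetherianRing R] {n : ℕ} {M X : Type u} [AddCommGroup M]
    [Module R M] [AddCommGroup X] [Module R X] (hM : ReflexiveDimLE R C n M)
    (hX : IsTotallyReflexive R C X) {b : M →ₗ[R] X} (hb : Function.Surjective b) :
    ReflexiveDimLE R C n (LinearMap.ker b) := by
  cases hM with
  | zero hM => exact .zero ((isShortExact_subtype_ker hb).isTotallyReflexive_left hM hX)
  | @succ _ K Y _ _ _ _ _ _ _ p q h hY hK =>
    refine .succ
      (a := p.codRestrict (LinearMap.ker (b ∘ₗ q)) fun x => by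
        simp [h.exact.apply_apply_eq_zero x])
      (b := (q ∘ₗ (LinearMap.ker (b ∘ₗ q)).subtype).codRestrict (LinearMap.ker b)
        fun x => x.2) ⟨?_, ?_, ?_⟩
      ((isShortExact_subtype_ker (b := b ∘ₗ q) (hb.comp h.surjective)).isTotallyReflexive_left hY hX) hK
    · exact fun x y hxy => h.injective (congrArg Subtype.val hxy)
    · intro x
      have := h.exact x.1
      simp only [Set.mem_range, Subtype.ext_iff] at this ⊢
      exact this
    · rintro ⟨x, hx⟩
      obtain ⟨y, rfl⟩ := h.surjective x
      exact ⟨⟨y, hx⟩, rfl⟩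

/-- A first syzygy of a module with a totally `C`-reflexive resolution of length `n + 1` has one of
length `n`. -/
theorem ReflexiveDimLE.syzygy [IsNoetherianRing R] (hC : IsSemidualizing R C) {n : ℕ}
    {M P : Type u} [AddCommGroup M] [Module R M] [AddCommGroup P] [Module R P] [Module.Finite R P]
    [Module.Projective R P] (hM : ReflexiveDimLE R C (n + 1) M) {p : P →ₗ[R] M}
    (hp : Function.Surjective p) : ReflexiveDimLE R C n (LinearMap.ker p) := by
  cases hM with
  | @succ _ K X _ _ _ _ _ _ _ a b h hX hK =>
    -- With `s` lifting `p` through `b`, the map `a + s : K × P → X` is onto and its kernel projects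
    -- isomorphically to `ker p`. As `K × P` has a resolution of length `n`, so does that kernel.
    obtain ⟨s, hs⟩ := Module.projective_lifting_property b p h.surjective
    have hs' : ∀ y, b (s y) = p y := LinearMap.congr_fun hs
    have hba : ∀ x, b (a x) = 0 := h.exact.apply_apply_eq_zero
    have hsurj : Function.Surjective (a.coprod s) := by
      intro x
      obtain ⟨y, hy⟩ := hp (b x)
      obtain ⟨z, hz⟩ := (h.exact (x - s y)).1 (by rw [map_sub, hs', hy, sub_self])
      exact ⟨(z, y), by simp [hz]⟩
    refine ((hK.prod_projective (P := P) hC).ker hX hsurj).of_equiv (LinearEquiv.ofBijective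
      ((LinearMap.snd R K P ∘ₗ (LinearMap.ker (a.coprod s)).subtype).codRestrict (LinearMap.ker p)
        ?_) ⟨?_, ?_⟩)
    · rintro ⟨⟨x, y⟩, hxy⟩
      have : b (a x + s y) = 0 := by
        rw [show a x + s y = 0 from hxy, map_zero]
      rw [map_add, hba, hs', zero_add] at this
      exact this
    · rw [injective_iff_map_eq_zero]
      rintro ⟨⟨x, y⟩, hxy⟩ h0
      obtain rfl : y = 0 := congrArg Subtype.val h0
      have hx : a x + s 0 = 0 := hxy
      rw [map_zero, add_zero, map_eq_zero_iff a h.injective] at hx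
      subst hx
      rfl
    · rintro ⟨y, hy⟩
      obtain ⟨x, hx⟩ := (h.exact (- s y)).1 (by rw [map_neg, hs', hy, neg_zero])
      exact ⟨⟨(x, y), by simp [hx]⟩, rfl⟩

end ReflexiveDim

/-! ### Comparison of transposes with Ext modules. -/

section Transpose

variable {R : Type u} [CommRing R]

theorem isShortExact_liftQ_range {A B D E : Type u} [AddCommGroup A] [Module R A] [AddCommGroup B]
    [Module R B] [AddCommGroup D] [Module R D] [AddCommGroup E] [Module R E] {u : A →ₗ[R] B}
    {v : B →ₗ[R] D} {w : D →ₗ[R] E} (huv : Function.Exact u v) (hvw : Function.Exact v w)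
    (hw : Function.Surjective w) :
    IsShortExact ((LinearMap.range u).liftQ v huv.linearMap_ker_eq.ge) w where
  injective := by
    rw [← LinearMap.ker_eq_bot]
    exact Submodule.ker_liftQ_eq_bot _ _ _ huv.linearMap_ker_eq.le
  exact := by
    rw [LinearMap.exact_iff, Submodule.range_liftQ]
    exact hvw.linearMap_ker_eq
  surjective := hw

/-- Dividing the first two terms by matching submodules does not change the third. -/
theorem IsShortExact.mapQ {B D E : Type u} [AddCommGroup B]
    [Module R B] [AddCommGroup D] [Module R D] [AddCommGroup E] [Module R E]
    {v : B →ₗ[R] D} {w : D →ₗ[R] E} (h : IsShortExact v w) {N : Submodule R B} {N' : Submodule R D}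
    (hN : N.map v = N') :
    IsShortExact (N.mapQ N' v (Submodule.map_le_iff_le_comap.1 hN.le))
      (N'.liftQ w (by
        rw [← hN, Submodule.map_le_iff_le_comap]
        exact fun x _ => h.exact.apply_apply_eq_zero x)) where
  injective := by
    rw [← LinearMap.ker_eq_bot]
    refine Submodule.ker_liftQ_eq_bot _ _ _ ?_
    intro x hx
    rw [LinearMap.ker_comp, Submodule.ker_mkQ, ← hN, Submodule.comap_map_eq_of_injective h.injective]
      at hx
    exact hx
  exact := by
    intro x
    obtain ⟨x, rfl⟩ := N'.mkQ_surjective x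
    constructor
    · intro hx
      obtain ⟨y, rfl⟩ := (h.exact x).1 hx
      exact ⟨N.mkQ y, rfl⟩
    · rintro ⟨y, hy⟩
      obtain ⟨y, rfl⟩ := N.mkQ_surjective y
      rw [← hy]
      exact h.exact.apply_apply_eq_zero y
  surjective := fun x => by
    obtain ⟨y, rfl⟩ := h.surjective x
    exact ⟨N'.mkQ y, rfl⟩

variable {C : Type u} [AddCommGroup C] [Module R C]

theorem nonempty_ext_transpose_equiv_ext_ext_one [IsNoetherianRing R] (hC : IsSemidualizing R C)
    {M P₁ P₀ : Type u} [AddCommGroup M] [Module R M] [AddCommGroup P₁] [Module R P₁]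
    [AddCommGroup P₀] [Module R P₀] {f : P₁ →ₗ[R] P₀} {g : P₀ →ₗ[R] M}
    (hfg : IsProjectivePresentation R f g) (hM : ReflexiveDimLE R C 1 M) {i : ℕ} (hi : 0 < i) :
    Nonempty (ExtMod R (Transpose R C f) C i ≃ₗ[R] ExtMod R (ExtMod R M C 1) C i) := by
  have := hfg.finite_one
  have := hfg.projective_one
  have := hfg.finite_zero
  have := hfg.projective_zero
  have hΩ : IsTotallyReflexive R C (LinearMap.ker g) := by
    cases hM.syzygy hC hfg.surjective with
    | zero h => exact h
  let f' : P₁ →ₗ[R] LinearMap.ker g := f.codRestrict _ fun x => hfg.exact.apply_apply_eq_zero x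
  have hf' : Function.Surjective f' := by
    rintro ⟨x, hx⟩
    obtain ⟨y, rfl⟩ := (hfg.exact x).1 hx
    exact ⟨y, rfl⟩
  have hL : IsTotallyReflexive R C (LinearMap.ker f') :=
    (isShortExact_subtype_ker hf').isTotallyReflexive_left hC.isTotallyReflexive_of_projective hΩ
  -- The map `f^C` factors as `P₀^C → Ω^C → P₁^C`. The quotient of `Ω^C` by the image of `P₀^C` is
  -- `Ext¹(M, C)`, which thus embeds in the transpose.
  have hN : (LinearMap.range (LinearMap.lcomp R C (LinearMap.ker g).subtype)).map
      (LinearMap.lcomp R C f') = LinearMap.range (LinearMap.lcomp R C f) := by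
    rw [← LinearMap.range_comp]
    rfl
  have hseq := ((isShortExact_subtype_ker hf').lcomp (hΩ.ext_eq_zero 1 one_pos)).mapQ hN
  obtain ⟨e⟩ := (isShortExact_subtype_ker hfg.surjective).nonempty_cokernel_equiv_ext_one
    (subsingleton_ext_of_projective C one_pos)
  exact ⟨(hseq.extMapEquiv (hL.ext_dual_eq_zero i hi) (hL.ext_dual_eq_zero (i + 1) i.succ_pos)).trans
    (extCongr C e.symm i)⟩

theorem nonempty_ext_transpose_equiv_ext_ext [IsNoetherianRing R] (hC : IsSemidualizing R C)
    (n : ℕ) {M P₁ P₀ : Type u} [AddCommGroup M] [Module R M] [AddCommGroup P₁] [Module R P₁]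
    [AddCommGroup P₀] [Module R P₀] {f : P₁ →ₗ[R] P₀} {g : P₀ →ₗ[R] M}
    (hfg : IsProjectivePresentation R f g) (hM : ReflexiveDimLE R C (n + 1) M)
    (hext : ∀ j, 0 < j → j < n + 1 → Subsingleton (ExtMod R M C j)) {i : ℕ} (hi : 0 < i) :
    Nonempty (ExtMod R (Transpose R C f) C i ≃ₗ[R]
      ExtMod R (ExtMod R M C (n + 1)) C (i + n)) := by
  induction n generalizing M P₁ P₀ i with
  | zero => exact nonempty_ext_transpose_equiv_ext_ext_one hC hfg hM hi
  | succ n ih =>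
    have := hfg.finite_one
    have := hfg.projective_one
    have := hfg.finite_zero
    have := hfg.projective_zero
    let f' : P₁ →ₗ[R] LinearMap.ker g := f.codRestrict _ fun x => hfg.exact.apply_apply_eq_zero x
    have hf' : Function.Surjective f' := by
      rintro ⟨x, hx⟩
      obtain ⟨y, rfl⟩ := (hfg.exact x).1 hx
      exact ⟨y, rfl⟩
    obtain ⟨m, q, hq⟩ := Module.Finite.exists_fin' R (LinearMap.ker f')
    let f₂ : (Fin m → R) →ₗ[R] P₁ := (LinearMap.ker f').subtype ∘ₗ q
    have hf₂ : Function.Exact f₂ f' := by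
      rw [LinearMap.exact_iff, LinearMap.range_comp, LinearMap.range_eq_top.2 hq]
      simp
    have hpres : IsProjectivePresentation R f₂ f' :=
      ⟨inferInstance, inferInstance, inferInstance, inferInstance, hf₂, hf'⟩
    have hΩ := isShortExact_subtype_ker hfg.surjective
    have hshift (j : ℕ) (hj : 0 < j) :
        ExtMod R (LinearMap.ker g) C j ≃ₗ[R] ExtMod R M C (j + 1) :=
      hΩ.connectingEquiv (subsingleton_ext_of_projective C hj)
        (subsingleton_ext_of_projective C j.succ_pos)
    -- The hypothesis is used in degree `i + 1`, to match the degree shift on the transposes below.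
    obtain ⟨e⟩ := ih hpres (hM.syzygy hC hfg.surjective) (fun j hj hjn => by
      have := hext (j + 1) j.succ_pos (by lia)
      exact (hshift j hj).injective.subsingleton) i.succ_pos
    -- Vanishing of `Ext¹(M, C)` makes `P₀^C → Ω^C` onto, so `f^C` has the same image as the dual of
    -- `f'`.
    have hres := hΩ.lcomp_surjective (hext 1 one_pos (by lia))
    have hdual : Function.Exact (LinearMap.lcomp R C f) (LinearMap.lcomp R C f₂) := by
      intro φ
      rw [LinearMap.exact_lcomp_of_exact_of_surjective C hf₂ hf' φ]
      constructor
      · rintro ⟨ψ, rfl⟩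
        obtain ⟨χ, rfl⟩ := hres ψ
        exact ⟨χ, rfl⟩
      · rintro ⟨χ, rfl⟩
        exact ⟨χ ∘ₗ (LinearMap.ker g).subtype, rfl⟩
    have hseq := isShortExact_liftQ_range hdual
      (w := (LinearMap.range (LinearMap.lcomp R C f₂)).mkQ)
      (LinearMap.exact_map_mkQ_range _) (Submodule.mkQ_surjective _)
    have hF : IsTotallyReflexive R C (Fin m → R) := hC.isTotallyReflexive_fin m
    have e₁ := hseq.connectingEquiv (hF.ext_dual_eq_zero i hi)
      (hF.ext_dual_eq_zero (i + 1) i.succ_pos)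
    rw [show i + (n + 1) = i + 1 + n by lia]
    exact ⟨(e₁.trans e).trans (extCongr C (hshift (n + 1) n.succ_pos).symm _)⟩

end Transpose

/-! ### Numerical consequences of the infimum definitions. -/

section Dimension

variable {R : Type u} [CommRing R] {C : Type u} [AddCommGroup C] [Module R C]
  {M : Type u} [AddCommGroup M] [Module R M] {n : ℕ}

/-- A finite infimum is attained: otherwise every resolution length would be at least `n + 1`. -/
theorem hasGCResolution_of_gcDim_eq (h : gcDim R C M = n) : HasGCResolution R C M n := by
  by_contra hn
  have : ((n + 1 : ℕ) : ℕ∞) ≤ gcDim R C M := le_iInf₂ fun m hm => by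
    have hnm : (n : ℕ∞) ≤ m := h ▸ iInf₂_le m hm
    have hne : n ≠ m := fun h' => hn (h' ▸ hm)
    norm_cast at hnm ⊢
    lia
  rw [h] at this
  norm_cast at this
  lia

theorem pos_of_rGrade_eq (h : rGrade R C M = n) : 0 < n := by
  have : ((1 : ℕ) : ℕ∞) ≤ rGrade R C M :=
    le_iInf₂ fun i hi => le_iInf fun _ => by exact_mod_cast hi
  rw [h] at this
  exact_mod_cast this

theorem subsingleton_ext_of_lt_rGrade (h : rGrade R C M = n) {j : ℕ} (hj : 0 < j) (hjn : j < n) :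
    Subsingleton (ExtMod R M C j) := by
  by_contra hs
  have hle : rGrade R C M ≤ j :=
    (iInf₂_le j hj).trans (iInf_le _ (not_subsingleton_iff_nontrivial.1 hs))
  rw [h] at hle
  norm_cast at hle
  lia

end Dimension

end RelG

theorem mainTheorem2 {R : Type u} [CommRing R] [IsNoetherianRing R]
    {C : Type u} [AddCommGroup C] [Module R C] (hC : RelG.IsSemidualizing R C)
    {M : Type u} [AddCommGroup M] [Module R M] (hM : RelG.IsReducedGCPerfect R C M)
    {n : ℕ} (hn : RelG.gcDim R C M = n)
    {P₁ P₀ : Type u} [AddCommGroup P₁] [Module R P₁] [AddCommGroup P₀] [Module R P₀]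
    {f : P₁ →ₗ[R] P₀} {g : P₀ →ₗ[R] M} (hfg : RelG.IsProjectivePresentation R f g)
    (i : ℕ) (hi : 0 < i) :
    Nonempty (RelG.ExtMod R (RelG.Transpose R C f) C i ≃ₗ[R]
      RelG.ExtMod R (RelG.ExtMod R M C n) C (i + n - 1)) := by
  have hgr : RelG.rGrade R C M = n := hM.rGrade_eq_gcDim.trans hn
  -- The reduced grade ranges over positive degrees, so `n` is a successor and the truncated
  -- subtraction in `i + n - 1` loses nothing.
  obtain ⟨n, rfl⟩ := Nat.exists_eq_succ_of_ne_zero (RelG.pos_of_rGrade_eq hgr).ne'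
  exact RelG.nonempty_ext_transpose_equiv_ext_ext hC n hfg
    (RelG.hasGCResolution_of_gcDim_eq hn).reflexiveDimLE
    (fun _ => RelG.subsingleton_ext_of_lt_rGrade hgr) hi
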